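/- **Theorem (Minimax-optimal bounds).** For $k\in\mathbb N$ let $\Delta_k$ be the set of probability distributions on $[k]=\{1,\dots,k\}$, and for $p,q\in\Delta_k$ let $d_{\mathrm{TV}}(p,q)=\frac12\sum_i|p_i-q_i|$ and $d_{\mathrm h}^2(p,q)=\sum_i(\sqrt{p_i}-\sqrt{q_i})^2$. A channel (stochastic map) $T:[k]\to\mathbb N$ is *$\epsilon$-LDP* if $\mathbb P[T(x)\in A]\le e^{\epsilon}\,\mathbb P[T(x')\in A]$ for all $x,x'\in[k]$ and $A\subseteq\mathbb N$. A *test-rule pair* $(\phi,\mathcal R)$ consists of a rule $\mathcal R$, which for every number $n$ of users assigns an $\epsilon$-LDP channel $T_i:[k]\to\mathbb N$ to each user $i\in[n]$, and of a test $\phi$, which maps each finite sequence of messages in $\mathbb N$ to one of the two answers "$p$", "$q$". With $n$ users, $X_1,\dots,X_n$ are drawn i.i.d. from $p$ or from $q$, and the messages $Y_i=T_i(X_i)$ are generated independently (private-coin, non-interactive). The pair $(\phi,\mathcal R)$ *solves* the problem for $(p,q)$ with $n$ samples if $$\mathbb P_{(X_1,\dots,X_n)\sim p^{\otimes n}}(\phi(Y_1,\dots,Y_n)\ne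 p)+\mathbb P_{(X_1,\dots,X_n)\sim q^{\otimes n}}(\phi(Y_1,\dots,Y_n)\ne q)\le 0.1 .$$ Let $\mathrm n^*(p,q,\epsilon)$ be the smallest $n$ such that some test-rule pair solves the problem for $(p,q)$ with $n$ samples. Let $S_{\rho,\nu}$ be the set of all pairs $(p,q)$ with $p,q\in\Delta_k$ for some $k\in\mathbb N$, $d_{\mathrm{TV}}(p,q)=\nu$ and $d_{\mathrm h}^2(p,q)=\rho$. Let $\mathrm n^*(S_{\rho,\nu},\epsilon)$ be the minimax sample complexity: the minimum, over all ways of choosing a test-rule pair for each $(p,q)\in S_{\rho,\nu}$, of the maximum over $(p,q)\in S_{\rho,\nu}$ of the smallest number of samples with which the chosen test-rule pair solves the problem for $(p,q)$; equivalently, $\mathrm n^*(S_{\rho,\nu},\epsilon)=\max_{(p,q)\in S_{\rho,\nu}}\mathrm n^*(p,q,\epsilon)$. There exist universal constants $C>0$ and $a\in\mathbb N$ such that, for all $\rho,\nu\in(0,\tfrac12)$ with $2\nu^2\le\rho\le\nu$ and all $\epsilon>0$, $\mathrm n^*(S_{\rho,\nu},\epsilon)$ is finite and, with $L:=\log(1/\nu)+\log(1/\rho)$,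 $$\frac{r}{C\,L^{a}}\;\le\;\mathrm n^*(S_{\rho,\nu},\epsilon)\;\le\; C\,L^{a}\, r$$ holds with $$r=\frac1{\epsilon^2\nu^2}\ \text{ if }\epsilon\le 1,\qquad r=\min\Big(\frac1{\nu^2},\frac1{e^{\epsilon}\rho^2}\Big)\ \text{ if } e\le e^{\epsilon}\le\frac1\rho,\qquad r=\frac1\rho\ \text{ if } e^{\epsilon}>\frac1\rho$$ (where several of the conditions hold, each of the corresponding bounds holds). -/

import Mathlib

open scoped BigOperators

noncomputable section

namespace LDPTesting

/-- `Simplex k` is the set `Δ_k` of probability distributions on `k` points, as vectors of reals. -/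
abbrev Simplex (k : ℕ) : Type := stdSimplex ℝ (Fin k)

/-- Total variation distance `½ ∑ |p_i - q_i|`. -/
def tv {k : ℕ} (p q : Simplex k) : ℝ :=
  (1 / 2) * ∑ i, |p i - q i|

/-- Hellinger divergence `∑ (√p_i - √q_i)²` (without a factor `½`). -/
def hellingerSq {k : ℕ} (p q : Simplex k) : ℝ :=
  ∑ i, (Real.sqrt (p i) - Real.sqrt (q i)) ^ 2

/-- A channel (a stochastic map) `T` from `X` to `Y` satisfies `ε`-local differential privacy:
`P[T(x) ∈ A] ≤ e^ε P[T(x') ∈ A]` for all inputs `x, x'` and all sets `A` of outputs. -/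
def IsLDP {X Y : Type} (ε : ℝ) (T : X → PMF Y) : Prop :=
  ∀ (x x' : X) (A : Set Y),
    (T x).toOuterMeasure A ≤ ENNReal.ofReal (Real.exp ε) * (T x').toOuterMeasure A

/-- The set of `ε`-LDP channels from `[k]` to `ℕ`. -/
abbrev LDPChannel (k : ℕ) (ε : ℝ) : Type :=
  {T : Fin k → PMF ℕ // IsLDP ε T}

/-- The two possible answers of a test for a pair `(p, q)`. -/
inductive Answer
  | isP
  | isQ

/-- A test: for each number of users, a decision from the messages `(Y_1, …, Y_n)`. -/
abbrev Test : Type := ∀ n : ℕ, (Fin n → ℕ) → Answer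

/-- A (deterministic, non-interactive) rule: for each number `n` of users, it assigns an `ε`-LDP
channel to each of the `n` users. -/
abbrev Rule (k : ℕ) (ε : ℝ) : Type := ∀ n : ℕ, Fin n → LDPChannel k ε

/-- A test-rule pair `(φ, R)`. -/
abbrev TestRule (k : ℕ) (ε : ℝ) : Type := Test × Rule k ε

/-- Probability that `(Y_1, …, Y_n) ∈ B`, where `(X_1, …, X_n) ∼ r^{⊗ n}` and, given the `X_i`,
the messages `Y_i = T_i(X_i)` are generated independently. -/
def messageProb {k n : ℕ} (r : Simplex k) (T : Fin n → (Fin k → PMF ℕ))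
    (B : Set (Fin n → ℕ)) : ℝ :=
  ∑ x : Fin n → Fin k,
    (∏ i, r (x i)) * (MeasureTheory.Measure.pi fun i => (T i (x i)).toMeasure).real B

/-- The test-rule pair solves the problem `B(p, q, ε)` with sample complexity `n`: its two error
probabilities with `n` users add up to at most `0.1`. -/
def Solves {k : ℕ} {ε : ℝ} (p q : Simplex k) (s : TestRule k ε) (n : ℕ) : Prop :=
  messageProb p (fun i => (s.2 n i).1) {y | s.1 n y ≠ Answer.isP} +
    messageProb q (fun i => (s.2 n i).1) {y | s.1 n y ≠ Answer.isQ} ≤ 1 / 10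

/-- The smallest `n` for which the given test-rule pair solves `B(p, q, ε)` (`⊤` if none). -/
def samplesOf {k : ℕ} {ε : ℝ} (p q : Simplex k) (s : TestRule k ε) : ℕ∞ :=
  ⨅ (n : ℕ) (_ : Solves p q s n), (n : ℕ∞)

/-- `n*(p, q, ε)`: the smallest `n` for which some test-rule pair solves `B(p, q, ε)`. -/
def nStar {k : ℕ} (p q : Simplex k) (ε : ℝ) : ℕ∞ :=
  ⨅ (n : ℕ) (_ : ∃ s : TestRule k ε, Solves p q s n), (n : ℕ∞)

/-- `S_{ρ,ν}`: all pairs of distributions on a common finite alphabet `[k]`, `k` arbitrary,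
with total variation distance `ν` and Hellinger divergence `ρ`. -/
def pairSet (ρ ν : ℝ) : Set (Σ k : ℕ, Simplex k × Simplex k) :=
  {x | tv x.2.1 x.2.2 = ν ∧ hellingerSq x.2.1 x.2.2 = ρ}

/-- The minimax sample complexity `n*(S_{ρ,ν}, ε)`: the minimum, over all ways to choose test-rule
pairs, of the maximal number of samples needed on a pair in `S_{ρ,ν}`.  As in `n*(p, q, ε)`, the
pair `(p, q)` is known when the test-rule pair is chosen. -/
def minimaxSamples (ρ ν ε : ℝ) : ℕ∞ :=
  ⨅ s : (∀ x : pairSet ρ ν, TestRule x.1.1 ε),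
    ⨆ x : pairSet ρ ν, samplesOf x.1.2.1 x.1.2.2 (s x)

/-- The minimax sample complexity is the largest `n*(p, q, ε)` with `(p, q) ∈ S_{ρ,ν}`. -/
theorem minimaxSamples_eq (ρ ν ε : ℝ) :
    minimaxSamples ρ ν ε = ⨆ x : pairSet ρ ν, nStar x.1.2.1 x.1.2.2 ε := by
  unfold minimaxSamples
  rw [← iSup_iInf_eq]
  refine iSup_congr fun x => ?_
  unfold samplesOf nStar
  rw [iInf_comm]
  exact iInf_congr fun n => (iInf_exists (p := fun s => Solves x.1.2.1 x.1.2.2 s n)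
    (f := fun _ => (n : ℕ∞))).symm

/-- `N` is finite and equal to `r` up to the factor `C · (log(1/ν) + log(1/ρ))^a`, in both
directions. -/
def EqUpToPolylog (C : ℝ) (a : ℕ) (ρ ν : ℝ) (N : ℕ∞) (r : ℝ) : Prop :=
  ∃ n : ℕ, N = n ∧
    r / (C * (Real.log (1 / ν) + Real.log (1 / ρ)) ^ a) ≤ n ∧
    n ≤ C * (Real.log (1 / ν) + Real.log (1 / ρ)) ^ a * r

end LDPTesting

end

open MeasureTheory ProbabilityTheory Finset
open scoped ENNReal

noncomputable section

namespace LDPTesting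

/-! ### The law of the messages -/

/-! Both directions reduce to one message. For the upper bound every user applies the same
randomized response to membership in a set `A`, and the test counts ones. If both biases are at most
`M`, Chebyshev shows that `n` samples suffice once `n` times the squared bias gap is at least `80 *
M` (`exists_solves_of_separation`). A set attaining the total variation, with `M = 1`, gives order
`1/(κ²ν²)` for `κ = (e^ε - 1)/(e^ε + 1)`. Alternatively, a dyadic pigeonhole over relative gaps `(p
- q)/p` finds `A` with `(p(A) - q(A))²` at least `τ max(p(A), q(A))` and `|p(A) - q(A)| ≥ τ`, where
`τ` is `ρ` up to a logarithm (`exists_binary_quantization`). Then `M` is about `e^{-ε} + max(p(A),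
q(A))`, and order `max(1/τ, 1/(e^ε τ²))` samples suffice.

For the lower bound, Hellinger affinity is multiplicative over users, so `n H ≥ 1` whenever no
private channel has output divergence above `H` (`one_le_mul_of_solves`). One pair on four points is
hard in all regimes: two light atoms of mass `x`, each charged by only one distribution, carry a
divergence of order `ρ`, while two heavy atoms supply the remaining variation `ν - x`. An output can
only be informative about the light atoms by being likely there, but privacy then makes it nearly as
likely, up to `e^ε`, on the heavy atoms. This bounds `H` by constant multiples of `ν²(e^ε - 1)²`,
`ρ` and `ν² + e^ε ρ²` (`exists_hard_pair`), matching the three regimes. -/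

theorem simplex_nonneg {k : ℕ} (r : Simplex k) (j : Fin k) : 0 ≤ r j := r.2.1 j

theorem simplex_sum {k : ℕ} (r : Simplex k) : ∑ j, r j = 1 := r.2.2

/-- The law of the message `T(X)` when `X ∼ r`. -/
def messageLaw {k : ℕ} (r : Simplex k) (T : Fin k → PMF ℕ) : Measure ℕ :=
  ∑ j, ENNReal.ofReal (r j) • (T j).toMeasure

theorem messageLaw_apply {k : ℕ} (r : Simplex k) (T : Fin k → PMF ℕ) (s : Set ℕ) :
    messageLaw r T s = ∑ j, ENNReal.ofReal (r j) * (T j).toMeasure s := by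
  simp [messageLaw, Measure.finsetSum_apply]

theorem sum_ofReal_simplex {k : ℕ} (r : Simplex k) : ∑ j, ENNReal.ofReal (r j) = 1 := by
  rw [← ENNReal.ofReal_sum_of_nonneg fun j _ => simplex_nonneg r j, simplex_sum r, ENNReal.ofReal_one]

instance isProbabilityMeasure_messageLaw {k : ℕ} (r : Simplex k) (T : Fin k → PMF ℕ) :
    IsProbabilityMeasure (messageLaw r T) :=
  ⟨by simp [messageLaw_apply, sum_ofReal_simplex]⟩

theorem messageLaw_real_singleton {k : ℕ} (r : Simplex k) (T : Fin k → PMF ℕ) (y : ℕ) :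
    (messageLaw r T).real {y} = ∑ j, r j * (T j y).toReal := by
  rw [measureReal_def, messageLaw_apply, ENNReal.toReal_sum]
  · refine Finset.sum_congr rfl fun j _ => ?_
    rw [ENNReal.toReal_mul, ENNReal.toReal_ofReal (simplex_nonneg r j),
      PMF.toMeasure_apply_singleton _ _ (measurableSet_singleton y)]
  · exact fun j _ => ENNReal.mul_ne_top ENNReal.ofReal_ne_top (measure_ne_top _ _)

/-- Averaging over i.i.d. inputs commutes with taking products, so the messages are independent;
from here on only product measures matter. -/
theorem messageProb_eq {k n : ℕ} (r : Simplex k) (T : Fin n → (Fin k → PMF ℕ))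
    (B : Set (Fin n → ℕ)) :
    messageProb r T B = (Measure.pi fun i => messageLaw r (T i)).real B := by
  have key : (Measure.pi fun i => messageLaw r (T i)) =
      ∑ x : Fin n → Fin k, ENNReal.ofReal (∏ i, r (x i)) •
        Measure.pi fun i => (T i (x i)).toMeasure := by
    refine Measure.pi_eq fun s _ => ?_
    simp only [Measure.finsetSum_apply, Measure.smul_apply, Measure.pi_pi, smul_eq_mul,
      messageLaw_apply]
    rw [Finset.prod_univ_sum, Fintype.piFinset_univ]
    refine Finset.sum_congr rfl fun x _ => ?_
    rw [ENNReal.ofReal_prod_of_nonneg fun i _ => simplex_nonneg r (x i), Finset.prod_mul_distrib]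
  rw [messageProb, measureReal_def, key, Measure.finsetSum_apply, ENNReal.toReal_sum]
  · refine Finset.sum_congr rfl fun x _ => ?_
    rw [Measure.smul_apply, smul_eq_mul, ENNReal.toReal_mul,
      ENNReal.toReal_ofReal (Finset.prod_nonneg fun i _ => simplex_nonneg r (x i)), measureReal_def]
  · exact fun x _ => by
      rw [Measure.smul_apply, smul_eq_mul]
      exact ENNReal.mul_ne_top ENNReal.ofReal_ne_top (measure_ne_top _ _)

/-! ### Randomized response -/

/-- A coin with bias `u`, with values `0` and `1`. -/
def coin (u : ℝ) (h0 : 0 ≤ u) (h1 : u ≤ 1) : PMF ℕ :=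
  PMF.ofFinset (fun y => if y = 1 then ENNReal.ofReal u else
    if y = 0 then ENNReal.ofReal (1 - u) else 0) {0, 1}
    (by
      rw [Finset.sum_pair zero_ne_one]
      simp only [zero_ne_one, if_false, if_true]
      rw [← ENNReal.ofReal_add (by linarith) h0]
      simp)
    (by intro a ha; simp at ha; simp [ha])

theorem coin_apply (u : ℝ) (h0 : 0 ≤ u) (h1 : u ≤ 1) (y : ℕ) :
    coin u h0 h1 y = if y = 1 then ENNReal.ofReal u else
      if y = 0 then ENNReal.ofReal (1 - u) else 0 := rfl

theorem isLDP_of_le {X Y : Type} {ε : ℝ} {T : X → PMF Y}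
    (h : ∀ x x' y, T x y ≤ ENNReal.ofReal (Real.exp ε) * T x' y) : IsLDP ε T := by
  intro x x' A
  rw [PMF.toOuterMeasure_apply, PMF.toOuterMeasure_apply, ← ENNReal.tsum_mul_left]
  refine ENNReal.tsum_le_tsum fun y => ?_
  by_cases hy : y ∈ A
  · simpa [hy] using h x x' y
  · simp [hy]

theorem IsLDP.toReal_le {X Y : Type} {ε : ℝ} {T : X → PMF Y} (h : IsLDP ε T) (x x' : X) (y : Y) :
    (T x y).toReal ≤ Real.exp ε * (T x' y).toReal := by
  have := h x x' {y}
  rw [PMF.toOuterMeasure_apply_singleton, PMF.toOuterMeasure_apply_singleton] at this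
  have h2 := ENNReal.toReal_mono
    (ENNReal.mul_ne_top ENNReal.ofReal_ne_top (PMF.apply_ne_top _ _)) this
  rwa [ENNReal.toReal_mul, ENNReal.toReal_ofReal (Real.exp_pos _).le] at h2

/-- The probability that randomized response tells whether the input lies in `A` as `1`. -/
def responseBias {k : ℕ} (ε : ℝ) (A : Finset (Fin k)) (x : Fin k) : ℝ :=
  if x ∈ A then Real.exp ε / (1 + Real.exp ε) else 1 / (1 + Real.exp ε)

theorem responseBias_nonneg {k : ℕ} (ε : ℝ) (A : Finset (Fin k)) (x : Fin k) :
    0 ≤ responseBias ε A x := by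
  unfold responseBias; split_ifs <;> positivity

theorem responseBias_le_one {k : ℕ} (ε : ℝ) (A : Finset (Fin k)) (x : Fin k) :
    responseBias ε A x ≤ 1 := by
  have := Real.exp_pos ε
  unfold responseBias
  split_ifs <;> rw [div_le_one (by linarith)] <;> linarith

/-- Randomized response on the membership in `A`. -/
def response {k : ℕ} (ε : ℝ) (A : Finset (Fin k)) (x : Fin k) : PMF ℕ :=
  coin (responseBias ε A x) (responseBias_nonneg ε A x) (responseBias_le_one ε A x)

theorem isLDP_response {k : ℕ} {ε : ℝ} (hε : 0 ≤ ε) (A : Finset (Fin k)) :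
    IsLDP ε (response ε A) := by
  have he : 1 ≤ Real.exp ε := Real.one_le_exp hε
  have h1 : 0 < 1 + Real.exp ε := by linarith
  have hb : ∀ x, 1 / (1 + Real.exp ε) ≤ responseBias ε A x ∧
      responseBias ε A x ≤ Real.exp ε / (1 + Real.exp ε) := by
    intro x
    have : 1 / (1 + Real.exp ε) ≤ Real.exp ε / (1 + Real.exp ε) := by gcongr
    unfold responseBias
    split_ifs <;> exact ⟨by linarith, by linarith⟩
  have hs : Real.exp ε / (1 + Real.exp ε) = Real.exp ε * (1 / (1 + Real.exp ε)) := by ring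
  have hs' : Real.exp ε / (1 + Real.exp ε) = 1 - 1 / (1 + Real.exp ε) := by field_simp; ring
  refine isLDP_of_le fun x x' y => ?_
  have hx := hb x
  have hx' := hb x'
  rw [response, response, coin_apply, coin_apply]
  split_ifs
  · rw [← ENNReal.ofReal_mul (Real.exp_pos ε).le]
    refine ENNReal.ofReal_le_ofReal (hx.2.trans ?_)
    rw [hs]
    gcongr
    exact hx'.1
  · rw [← ENNReal.ofReal_mul (Real.exp_pos ε).le]
    refine ENNReal.ofReal_le_ofReal ?_
    calc 1 - responseBias ε A x ≤ Real.exp ε * (1 / (1 + Real.exp ε)) := by linarith [hx.1]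
      _ ≤ _ := by gcongr; linarith [hx'.2]
  · simp

theorem messageLaw_response_one {k : ℕ} (ε : ℝ) (A : Finset (Fin k)) (r : Simplex k) :
    (messageLaw r (response ε A)).real {1} = 1 / (1 + Real.exp ε) +
      (Real.exp ε - 1) / (1 + Real.exp ε) * ∑ i ∈ A, r i := by
  have h1 : 0 < 1 + Real.exp ε := by positivity
  have : ∀ j, r j * (response ε A j 1).toReal = 1 / (1 + Real.exp ε) * r j +
      (Real.exp ε - 1) / (1 + Real.exp ε) * (if j ∈ A then r j else 0) := by
    intro j
    rw [response, coin_apply, if_pos rfl, ENNReal.toReal_ofReal (responseBias_nonneg ε A j),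
      responseBias]
    split_ifs
    · field_simp; ring
    · ring
  rw [messageLaw_real_singleton, Finset.sum_congr rfl fun j _ => this j, Finset.sum_add_distrib,
    ← Finset.mul_sum, ← Finset.mul_sum, simplex_sum, Finset.sum_ite_mem, Finset.univ_inter]
  ring

/-! ### Counting the messages equal to `1` -/

/-- The number of messages equal to `1`. -/
def countOnes {n : ℕ} : (Fin n → ℕ) → ℝ :=
  ∑ i, fun y => Set.indicator {1} (fun _ => (1 : ℝ)) (y i)

/-- Chebyshev, with the variance of an indicator bounded by its mean. Keeping the mean, rather than
a constant, is what makes rare sets `A` useful. -/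
theorem countOnes_concentration {n : ℕ} (μ : Measure ℕ) [IsProbabilityMeasure μ] {c : ℝ}
    (hc : 0 < c) :
    (Measure.pi fun _ : Fin n => μ).real {y | c ≤ |countOnes y - n * μ.real {1}|} ≤
      n * μ.real {1} / c ^ 2 := by
  let X : ℕ → ℝ := Set.indicator {1} fun _ => (1 : ℝ)
  have hX : MemLp X 2 μ := memLp_indicator_const 2 (measurableSet_singleton 1) 1 (by simp)
  have hE : ∫ y, X y ∂μ = μ.real {1} := by
    rw [integral_indicator_const _ (measurableSet_singleton 1), smul_eq_mul, mul_one]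
  have hV : variance X μ ≤ μ.real {1} := by
    refine (variance_le_expectation_sq hX.1).trans (le_of_eq ?_)
    rw [← hE]
    congr 1 with y
    by_cases hy : y = 1 <;> simp [X, hy]
  have hm : ∀ i : Fin n, MemLp (fun y : Fin n → ℕ => X (y i)) 2 (Measure.pi fun _ => μ) :=
    fun i => hX.comp_measurePreserving (measurePreserving_eval (fun _ => μ) i)
  have hcount : MemLp (countOnes (n := n)) 2 (Measure.pi fun _ => μ) :=
    memLp_finsetSum' _ fun i _ => hm i
  have hmean : ∫ y, countOnes y ∂(Measure.pi fun _ : Fin n => μ) = n * μ.real {1} := by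
    have h1 : ∀ i : Fin n, ∫ y, X (y i) ∂(Measure.pi fun _ : Fin n => μ) = μ.real {1} := by
      intro i
      rw [integral_comp_eval (μ := fun _ : Fin n => μ) (i := i) hX.1, hE]
    simp only [countOnes, Finset.sum_apply]
    rw [integral_finsetSum _ fun i _ => (hm i).integrable one_le_two,
      Finset.sum_congr rfl fun i _ => h1 i]
    simp
  have hvar : variance (countOnes (n := n)) (Measure.pi fun _ => μ) ≤ n * μ.real {1} := by
    have := variance_sum_pi (μ := fun _ : Fin n => μ) (X := fun _ => X) fun _ => hX
    unfold countOnes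
    rw [this]
    simp only [Finset.sum_const, Finset.card_univ, Fintype.card_fin, nsmul_eq_mul]
    gcongr
  have hch := meas_ge_le_variance_div_sq hcount hc
  rw [hmean] at hch
  have hv := variance_nonneg (countOnes (n := n)) (Measure.pi fun _ => μ)
  refine (ENNReal.toReal_le_of_le_ofReal (by positivity) hch).trans ?_
  gcongr

open Classical in
/-- A constant privatized coin whose bias separates `p` from `q` solves the problem. -/
theorem exists_solves_of_separation {k n : ℕ} {ε M : ℝ} (p q : Simplex k) (T : LDPChannel k ε)
    (hn : 0 < n) (hM : 0 < M)
    (hp : (messageLaw p T.1).real {1} ≤ M) (hq : (messageLaw q T.1).real {1} ≤ M)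
    (h : 80 * M ≤ n * ((messageLaw p T.1).real {1} - (messageLaw q T.1).real {1}) ^ 2) :
    ∃ s : TestRule k ε, Solves p q s n := by
  set a := (messageLaw p T.1).real {1}
  set b := (messageLaw q T.1).real {1}
  have hn' : (0 : ℝ) < n := by exact_mod_cast hn
  have hd : 0 < |a - b| := by
    refine abs_pos.2 fun h0 => ?_
    rw [h0] at h
    norm_num at h
    linarith
  have hc : 0 < n * |a - b| / 2 := by positivity
  -- The threshold is half the distance between the two expected counts; a two-sided deviation
  -- avoids asking which bias is larger.
  refine ⟨⟨fun m y => if n * |a - b| / 2 ≤ |countOnes y - n * a| then .isQ else .isP,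
    fun _ _ => T⟩, ?_⟩
  unfold Solves
  rw [messageProb_eq, messageProb_eq]
  -- The constant 80 gives each error `4M / (n (a - b)²) ≤ 1/20`.
  have tail : ∀ x ≤ M, n * x / (n * |a - b| / 2) ^ 2 ≤ 1 / 20 := by
    intro x hx
    rw [div_le_iff₀ (by positivity), div_pow, mul_pow, sq_abs]
    nlinarith
  have h1 := (countOnes_concentration (n := n) (messageLaw p T.1) hc).trans (tail a hp)
  have h2 := (countOnes_concentration (n := n) (messageLaw q T.1) hc).trans (tail b hq)
  have e1 : ({y | (if n * |a - b| / 2 ≤ |countOnes y - n * a| then Answer.isQ else .isP) ≠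
      Answer.isP} : Set (Fin n → ℕ)) = {y | n * |a - b| / 2 ≤ |countOnes y - n * a|} := by
    ext y
    by_cases hy : n * |a - b| / 2 ≤ |countOnes y - n * a| <;> simp [hy]
  have e2 : ({y | (if n * |a - b| / 2 ≤ |countOnes y - n * a| then Answer.isQ else .isP) ≠
      Answer.isQ} : Set (Fin n → ℕ)) ⊆ {y | n * |a - b| / 2 ≤ |countOnes y - n * b|} := by
    intro y hy
    by_cases hy' : n * |a - b| / 2 ≤ |countOnes y - n * a|
    · exact absurd (if_pos hy') hy
    · have := abs_sub_le (n * a) (countOnes y) (n * b)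
      rw [← mul_sub, abs_mul, abs_of_pos hn', abs_sub_comm (n * a)] at this
      simp only [Set.mem_ofPred_eq]
      linarith
  have h3 := (measureReal_mono (μ := Measure.pi fun _ : Fin n => messageLaw q T.1) e2).trans h2
  rw [← e1] at h1
  exact (add_le_add h1 h3).trans (by norm_num)

/-! ### Upper bounds -/

/-- Randomized response on `A` gives an upper bound on the sample complexity. -/
theorem nStar_le_of_separation {k : ℕ} {ε h M : ℝ} (hε : 0 ≤ ε) (p q : Simplex k)
    (A : Finset (Fin k)) (hh : 0 < h) (hM : 0 < M)
    (hp : 1 / (1 + Real.exp ε) +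
      (Real.exp ε - 1) / (1 + Real.exp ε) * ∑ i ∈ A, p i ≤ M)
    (hq : 1 / (1 + Real.exp ε) +
      (Real.exp ε - 1) / (1 + Real.exp ε) * ∑ i ∈ A, q i ≤ M)
    (hs : h * M ≤ ((Real.exp ε - 1) / (1 + Real.exp ε)) ^ 2 *
      (∑ i ∈ A, p i - ∑ i ∈ A, q i) ^ 2) :
    nStar p q ε ≤ (⌈80 / h⌉₊ : ℕ) := by
  have hn : 0 < ⌈80 / h⌉₊ := Nat.ceil_pos.2 (by positivity)
  have hle : 80 ≤ (⌈80 / h⌉₊ : ℝ) * h := by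
    rw [← div_le_iff₀ hh]; exact Nat.le_ceil _
  refine iInf₂_le (f := fun (n : ℕ) _ => (n : ℕ∞)) _ (exists_solves_of_separation p q ⟨response ε A, isLDP_response hε A⟩ hn hM
    (by rwa [messageLaw_response_one]) (by rwa [messageLaw_response_one]) ?_)
  rw [messageLaw_response_one, messageLaw_response_one, add_sub_add_left_eq_sub, ← mul_sub, mul_pow]
  calc 80 * M ≤ ⌈80 / h⌉₊ * h * M := by gcongr
    _ = ⌈80 / h⌉₊ * (h * M) := by ring
    _ ≤ _ := by gcongr

theorem sum_simplex_le_one {k : ℕ} (r : Simplex k) (A : Finset (Fin k)) : ∑ i ∈ A, r i ≤ 1 := by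
  rw [← simplex_sum r]
  exact Finset.sum_le_sum_of_subset_of_nonneg (Finset.subset_univ _) fun i _ _ => simplex_nonneg r i

/-- The total variation distance is attained on a set. -/
theorem exists_sum_sub_sum_eq_tv {k : ℕ} (p q : Simplex k) :
    ∃ A : Finset (Fin k), ∑ i ∈ A, p i - ∑ i ∈ A, q i = tv p q := by
  refine ⟨Finset.univ.filter fun i => q i ≤ p i, ?_⟩
  rw [← Finset.sum_sub_distrib, Finset.sum_filter, tv, Finset.mul_sum]
  have h : ∑ i, (p i - q i) / 2 = 0 := by
    rw [← Finset.sum_div, Finset.sum_sub_distrib, simplex_sum, simplex_sum, sub_self, zero_div]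
  rw [← sub_eq_zero, ← Finset.sum_sub_distrib]
  refine (Finset.sum_congr rfl fun i _ => ?_).trans h
  split_ifs with hi
  · rw [abs_of_nonneg (sub_nonneg.2 hi)]; ring
  · rw [abs_of_neg (sub_neg.2 (not_le.1 hi))]; ring

theorem nStar_le_tv {k : ℕ} {ε κ : ℝ} (hε : 0 ≤ ε) (p q : Simplex k) (hκ : 0 < κ)
    (hκ' : κ ≤ (Real.exp ε - 1) / (1 + Real.exp ε)) (htv : 0 < tv p q) :
    nStar p q ε ≤ (⌈80 / (κ ^ 2 * tv p q ^ 2)⌉₊ : ℕ) := by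
  obtain ⟨A, hA⟩ := exists_sum_sub_sum_eq_tv p q
  have he := Real.exp_pos ε
  have hκ0 : 0 ≤ (Real.exp ε - 1) / (1 + Real.exp ε) := hκ.le.trans hκ'
  have hb : ∀ r : Simplex k, 1 / (1 + Real.exp ε) +
      (Real.exp ε - 1) / (1 + Real.exp ε) * ∑ i ∈ A, r i ≤ 1 := by
    intro r
    calc _ ≤ 1 / (1 + Real.exp ε) + (Real.exp ε - 1) / (1 + Real.exp ε) * 1 := by
          gcongr; exact sum_simplex_le_one r A
      _ ≤ 1 := by
        rw [mul_one, ← add_div]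
        exact (div_le_one (by positivity)).2 (by linarith)
  refine nStar_le_of_separation hε p q A (by positivity) one_pos (hb p) (hb q) ?_
  rw [hA, mul_one]
  gcongr

/-- A bounded function is approximated by its dyadic level sets. -/
theorem sq_le_sum_dyadic {t : ℝ} (h0 : 0 ≤ t) (h1 : t ≤ 1) (J : ℕ) :
    t ^ 2 ≤ ∑ j ∈ Finset.range J, (if (1 / 2 : ℝ) ^ (j + 1) ≤ t then (1 / 4 : ℝ) ^ j else 0) +
      (1 / 4 : ℝ) ^ J := by
  induction J with
  | zero => simpa [abs_of_nonneg h0] using h1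
  | succ J ih =>
    rw [Finset.sum_range_succ]
    -- If level `J` is reached, its summand equals the old error term; otherwise `t²` is below the
    -- new error term.
    split_ifs with h
    · have : (0 : ℝ) < (1 / 4) ^ (J + 1) := by positivity
      linarith
    · have hs : 0 ≤ ∑ j ∈ Finset.range J,
          (if (1 / 2 : ℝ) ^ (j + 1) ≤ t then (1 / 4 : ℝ) ^ j else 0) :=
        Finset.sum_nonneg fun j _ => by split_ifs <;> positivity
      have : t ^ 2 ≤ ((1 / 2 : ℝ) ^ (J + 1)) ^ 2 := by gcongr; exact (not_le.1 h).le
      rw [← pow_mul, mul_comm, pow_mul] at this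
      norm_num at this ⊢
      linarith

/-- Since `√b ≤ √a`, one has `√a (√a - √b) ≤ a - b`. The relative gap is written out because level
sets are cut along it. -/
theorem sq_sqrt_sub_sqrt_le {a b : ℝ} (hb : 0 ≤ b) (hab : b < a) :
    (Real.sqrt a - Real.sqrt b) ^ 2 ≤ a * ((a - b) / a) ^ 2 := by
  have ha : 0 < a := hb.trans_lt hab
  have h1 : Real.sqrt b ≤ Real.sqrt a := Real.sqrt_le_sqrt hab.le
  have h2 : 0 < Real.sqrt a := Real.sqrt_pos.2 ha
  have h3 : 0 ≤ Real.sqrt b := Real.sqrt_nonneg b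
  have key : Real.sqrt a * (Real.sqrt a - Real.sqrt b) ≤ a - b := by
    nlinarith [Real.sq_sqrt ha.le, Real.sq_sqrt hb]
  have : a * ((a - b) / a) ^ 2 = (a - b) ^ 2 / a := by field_simp
  rw [this, le_div_iff₀ ha]
  calc (Real.sqrt a - Real.sqrt b) ^ 2 * a = (Real.sqrt a * (Real.sqrt a - Real.sqrt b)) ^ 2 := by
        rw [mul_pow, Real.sq_sqrt ha.le]; ring
    _ ≤ _ := by
      have := mul_nonneg h2.le (sub_nonneg.2 h1)
      gcongr

/-- One level set of the likelihood ratio keeps the one-sided Hellinger divergence, up to the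
number of dyadic levels. -/
theorem exists_level_set {k : ℕ} (p q : Simplex k) {ρ : ℝ} {J : ℕ} (hJ : 0 < J)
    (hJ' : (1 / 4 : ℝ) ^ J ≤ ρ / 4)
    (h : ρ / 2 ≤ ∑ i with q i < p i, (Real.sqrt (p i) - Real.sqrt (q i)) ^ 2) :
    ∃ A : Finset (Fin k), ρ / (16 * J) * ∑ i ∈ A, p i ≤ (∑ i ∈ A, p i - ∑ i ∈ A, q i) ^ 2 ∧
      ρ / (16 * J) ≤ ∑ i ∈ A, p i - ∑ i ∈ A, q i := by
  let t : Fin k → ℝ := fun i => (p i - q i) / p i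
  let A : ℕ → Finset (Fin k) := fun j =>
    (Finset.univ.filter fun i => q i < p i).filter fun i => (1 / 2 : ℝ) ^ (j + 1) ≤ t i
  have hJr : (0 : ℝ) < J := by exact_mod_cast hJ
  have hsum : ρ / 2 ≤ ∑ j ∈ Finset.range J, (1 / 4 : ℝ) ^ j * ∑ i ∈ A j, p i + (1 / 4 : ℝ) ^ J := by
    calc ρ / 2 ≤ ∑ i with q i < p i, (Real.sqrt (p i) - Real.sqrt (q i)) ^ 2 := h
      _ ≤ ∑ i with q i < p i, (∑ j ∈ Finset.range J,
            (if (1 / 2 : ℝ) ^ (j + 1) ≤ t i then (1 / 4 : ℝ) ^ j * p i else 0) +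
            (1 / 4 : ℝ) ^ J * p i) := by
          refine Finset.sum_le_sum fun i hi => ?_
          have hi' : q i < p i := (Finset.mem_filter.1 hi).2
          have hp : 0 < p i := (simplex_nonneg q i).trans_lt hi'
          refine (sq_sqrt_sub_sqrt_le (simplex_nonneg q i) hi').trans ?_
          have := sq_le_sum_dyadic (t := t i) (div_nonneg (sub_nonneg.2 hi'.le) hp.le)
            ((div_le_one hp).2 (by linarith [simplex_nonneg q i])) J
          have := mul_le_mul_of_nonneg_right this hp.le
          rw [add_mul, Finset.sum_mul] at this
          simp only [ite_mul, zero_mul] at this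
          rwa [mul_comm]
      _ = ∑ j ∈ Finset.range J, (1 / 4 : ℝ) ^ j * ∑ i ∈ A j, p i +
            (1 / 4 : ℝ) ^ J * ∑ i with q i < p i, p i := by
          rw [Finset.sum_add_distrib, Finset.sum_comm, Finset.mul_sum]
          simp only [A, Finset.sum_filter _ (s := Finset.filter _ _), Finset.mul_sum, mul_ite,
            mul_zero]
      _ ≤ _ := by
          have := sum_simplex_le_one p (Finset.univ.filter fun i => q i < p i)
          have h4 : (0 : ℝ) < (1 / 4) ^ J := by positivity
          nlinarith
  -- Pigeonhole: truncation costs at most `ρ/4` of `ρ/2`, so one of the `J` levels holds at least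
  -- `ρ/(4J)`.
  obtain ⟨j, -, hj⟩ : ∃ j ∈ Finset.range J, ρ / (4 * J) ≤ (1 / 4 : ℝ) ^ j * ∑ i ∈ A j, p i := by
    refine Finset.exists_le_of_sum_le (Finset.nonempty_range_iff.2 hJ.ne') ?_
    rw [Finset.sum_const, Finset.card_range, nsmul_eq_mul]
    have : (J : ℝ) * (ρ / (4 * J)) = ρ / 4 := by field_simp
    linarith
  set s : ℝ := (1 / 2 : ℝ) ^ (j + 1) with hs
  have hs0 : 0 < s := by positivity
  have hs1 : s ≤ 1 := pow_le_one₀ (by norm_num) (by norm_num)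
  have hs2 : (1 / 4 : ℝ) ^ j = 4 * s ^ 2 := by
    rw [hs, pow_right_comm, pow_succ _ j]; norm_num; ring
  have hP : 0 ≤ ∑ i ∈ A j, p i := Finset.sum_nonneg fun i _ => simplex_nonneg p i
  have hd : s * ∑ i ∈ A j, p i ≤ ∑ i ∈ A j, p i - ∑ i ∈ A j, q i := by
    rw [Finset.mul_sum, ← Finset.sum_sub_distrib]
    refine Finset.sum_le_sum fun i hi => ?_
    obtain ⟨hi1, hi2⟩ := Finset.mem_filter.1 hi
    have hi1' : q i < p i := (Finset.mem_filter.1 hi1).2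
    exact (le_div_iff₀ ((simplex_nonneg q i).trans_lt hi1')).1 hi2
  -- With `P` the `p`-mass of `A j`, the gap is at least `sP`. Both claims follow from `s²P ≥
  -- ρ/(16J)`, via `(sP)² = (s²P)P` and `sP ≥ s²P`.
  have hτ : ρ / (16 * J) ≤ s ^ 2 * ∑ i ∈ A j, p i := by
    have : ρ / (16 * J) = ρ / (4 * J) / 4 := by field_simp; norm_num
    rw [hs2] at hj
    linarith
  refine ⟨A j, ?_, ?_⟩
  · calc _ ≤ (s ^ 2 * ∑ i ∈ A j, p i) * ∑ i ∈ A j, p i := by gcongr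
      _ = (s * ∑ i ∈ A j, p i) ^ 2 := by ring
      _ ≤ _ := by gcongr
  · refine hτ.trans (le_trans ?_ hd)
    gcongr
    nlinarith

/-- Binary quantization of the Hellinger divergence. -/
theorem exists_binary_quantization {k : ℕ} (p q : Simplex k) {J : ℕ} (hJ : 0 < J)
    (hρ : 0 < hellingerSq p q) (hJ' : (1 / 4 : ℝ) ^ J ≤ hellingerSq p q / 4) :
    ∃ A : Finset (Fin k),
      hellingerSq p q / (16 * J) * max (∑ i ∈ A, p i) (∑ i ∈ A, q i) ≤
        (∑ i ∈ A, p i - ∑ i ∈ A, q i) ^ 2 ∧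
      hellingerSq p q / (16 * J) ≤ |∑ i ∈ A, p i - ∑ i ∈ A, q i| := by
  have hτ : 0 < hellingerSq p q / (16 * J) := by positivity
  have split : hellingerSq p q =
      ∑ i with q i < p i, (Real.sqrt (p i) - Real.sqrt (q i)) ^ 2 +
      ∑ i with p i < q i, (Real.sqrt (q i) - Real.sqrt (p i)) ^ 2 := by
    rw [hellingerSq, Finset.sum_filter, Finset.sum_filter, ← Finset.sum_add_distrib]
    refine Finset.sum_congr rfl fun i _ => ?_
    rcases lt_trichotomy (p i) (q i) with h | h | h
    · rw [if_neg h.not_gt, if_pos h, zero_add, sub_sq_comm]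
    · simp [h]
    · rw [if_neg h.not_gt, if_pos h, add_zero]
  rcases le_or_gt (hellingerSq p q / 2)
    (∑ i with q i < p i, (Real.sqrt (p i) - Real.sqrt (q i)) ^ 2) with h | h
  · obtain ⟨A, h1, h2⟩ := exists_level_set p q hJ hJ' h
    refine ⟨A, ?_, h2.trans (le_abs_self _)⟩
    rwa [max_eq_left (by linarith)]
  · obtain ⟨A, h1, h2⟩ := exists_level_set q p hJ hJ' (by linarith)
    refine ⟨A, ?_, h2.trans (abs_sub_comm (∑ i ∈ A, q i) _ ▸ le_abs_self _)⟩
    rwa [max_eq_right (by linarith), sub_sq_comm]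

theorem one_third_le_of_two_le_exp {ε : ℝ} (hε : 2 ≤ Real.exp ε) :
    1 / 3 ≤ (Real.exp ε - 1) / (1 + Real.exp ε) := by
  rw [div_le_div_iff₀ (by norm_num) (by linarith)]
  linarith

/-- Upper bound through a binary quantization followed by randomized response. -/
theorem nStar_le_hellinger {k : ℕ} {ε τ : ℝ} (hε : 2 ≤ Real.exp ε) (p q : Simplex k) {J : ℕ} (hJ : 0 < J)
    (hρ : 0 < hellingerSq p q) (hJ' : (1 / 4 : ℝ) ^ J ≤ hellingerSq p q / 4)
    (hτ : 0 < τ) (hτ' : τ ≤ hellingerSq p q / (16 * J)) :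
    nStar p q ε ≤ (⌈80 / (min τ (Real.exp ε * τ ^ 2) / 18)⌉₊ : ℕ) := by
  obtain ⟨A, h1, h2⟩ := exists_binary_quantization p q hJ hρ hJ'
  have he := Real.exp_pos ε
  have hκ := one_third_le_of_two_le_exp hε
  have hκ1 : (Real.exp ε - 1) / (1 + Real.exp ε) ≤ 1 := (div_le_one (by linarith)).2 (by linarith)
  set κ := (Real.exp ε - 1) / (1 + Real.exp ε)
  set a := ∑ i ∈ A, p i
  set b := ∑ i ∈ A, q i
  have ha : 0 ≤ a := Finset.sum_nonneg fun i _ => simplex_nonneg p i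
  have hb : 0 ≤ b := Finset.sum_nonneg fun i _ => simplex_nonneg q i
  have hm : 0 ≤ max a b := le_max_of_le_left ha
  have hδ : 1 / (1 + Real.exp ε) ≤ 1 / Real.exp ε := by gcongr; linarith
  have hbound : ∀ x, 0 ≤ x → x ≤ max a b → 1 / (1 + Real.exp ε) + κ * x ≤
      1 / Real.exp ε + max a b := fun x hx hxm => by nlinarith
  refine nStar_le_of_separation (Real.one_le_exp_iff.1 (by linarith)) p q A (by positivity)
    (M := 1 / Real.exp ε + max a b) (by positivity)
    (hbound a ha (le_max_left _ _)) (hbound b hb (le_max_right _ _)) ?_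
  have e1 : τ * max a b ≤ (a - b) ^ 2 := le_trans (by gcongr) h1
  have e2 : τ ^ 2 ≤ (a - b) ^ 2 := by
    rw [← sq_abs (a - b)]; gcongr; exact hτ'.trans h2
  -- Each entry of the minimum handles one summand of `M`. The factor 18 is 2 for the two summands
  -- times 9 from `κ ≥ 1/3`.
  calc min τ (Real.exp ε * τ ^ 2) / 18 * (1 / Real.exp ε + max a b)
      = (min τ (Real.exp ε * τ ^ 2) * (1 / Real.exp ε) +
          min τ (Real.exp ε * τ ^ 2) * max a b) / 18 := by ring
    _ ≤ (Real.exp ε * τ ^ 2 * (1 / Real.exp ε) + τ * max a b) / 18 := by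
        gcongr
        · exact min_le_right _ _
        · exact min_le_left _ _
    _ = (τ ^ 2 + τ * max a b) / 18 := by field_simp
    _ ≤ (1 / 3) ^ 2 * (a - b) ^ 2 := by linarith
    _ ≤ _ := by gcongr

/-! ### Hellinger lower bound on the number of samples -/

theorem sum_range_real_singleton_le_one (μ : Measure ℕ) [IsProbabilityMeasure μ] (N : ℕ) :
    ∑ y ∈ Finset.range N, μ.real {y} ≤ 1 := by
  rw [sum_measureReal_singleton]; exact measureReal_le_one

theorem tendsto_sum_real_singleton (μ : Measure ℕ) [IsProbabilityMeasure μ] :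
    Filter.Tendsto (fun N => ∑ y ∈ Finset.range N, μ.real {y}) Filter.atTop (nhds 1) := by
  have hmono : Monotone fun N : ℕ => ((Finset.range N : Finset ℕ) : Set ℕ) :=
    fun _ _ h => Finset.coe_subset.2 (Finset.range_mono h)
  have h := tendsto_measure_iUnion_atTop (μ := μ) hmono
  have hu : ⋃ N : ℕ, ((Finset.range N : Finset ℕ) : Set ℕ) = Set.univ :=
    Set.eq_univ_of_forall fun y => Set.mem_iUnion.2 ⟨y + 1, by simp⟩
  rw [hu, measure_univ] at h
  simp only [sum_measureReal_singleton]
  exact (ENNReal.tendsto_toReal ENNReal.one_ne_top).comp h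

open Classical in
/-- Testing error controls the Hellinger affinity of product measures. -/
theorem prod_affinity_le {n : ℕ} (μ ν : Fin n → Measure ℕ) [∀ i, IsProbabilityMeasure (μ i)]
    [∀ i, IsProbabilityMeasure (ν i)] (B : Set (Fin n → ℕ)) (N : ℕ) :
    ∏ i, ∑ y ∈ Finset.range N, Real.sqrt ((μ i).real {y}) * Real.sqrt ((ν i).real {y}) ≤
      Real.sqrt ((Measure.pi μ).real B) + Real.sqrt ((Measure.pi ν).real Bᶜ) := by
  have hsing : ∀ (μ : Fin n → Measure ℕ) [∀ i, IsProbabilityMeasure (μ i)] (y : Fin n → ℕ),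
      ∏ i, Real.sqrt ((μ i).real {y i}) = Real.sqrt ((Measure.pi μ).real {y}) := by
    intro μ _ y
    rw [measureReal_def, Measure.pi_singleton, ENNReal.toReal_prod,
      Real.sqrt_prod _ fun i _ => ENNReal.toReal_nonneg]
    rfl
  have hle : ∀ (μ : Fin n → Measure ℕ) [∀ i, IsProbabilityMeasure (μ i)]
      (G : Finset (Fin n → ℕ)) (D : Set (Fin n → ℕ)), (∀ y ∈ G, y ∈ D) →
      ∑ y ∈ G, (Measure.pi μ).real {y} ≤ (Measure.pi μ).real D := by
    intro μ _ G D h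
    rw [sum_measureReal_singleton]
    exact measureReal_mono fun y hy => h y hy
  rw [Finset.prod_univ_sum]
  simp only [Finset.prod_mul_distrib, hsing]
  -- Cauchy–Schwarz on `B` and on its complement; each time the other measure's mass is bounded by
  -- 1.
  rw [← Finset.sum_filter_add_sum_filter_not _ (· ∈ B)]
  refine add_le_add ?_ ?_
  · refine (Real.sum_sqrt_mul_sqrt_le _ (fun _ => measureReal_nonneg)
      fun _ => measureReal_nonneg).trans ?_
    rw [← mul_one (Real.sqrt ((Measure.pi μ).real B))]
    refine mul_le_mul (Real.sqrt_le_sqrt (hle μ _ B fun y hy => (Finset.mem_filter.1 hy).2))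
      (Real.sqrt_le_one.2 ((hle ν _ Set.univ fun y _ => Set.mem_univ y).trans
        measureReal_le_one)) (Real.sqrt_nonneg _) (Real.sqrt_nonneg _)
  · refine (Real.sum_sqrt_mul_sqrt_le _ (fun _ => measureReal_nonneg)
      fun _ => measureReal_nonneg).trans ?_
    rw [← one_mul (Real.sqrt ((Measure.pi ν).real Bᶜ))]
    refine mul_le_mul (Real.sqrt_le_one.2 ((hle μ _ Set.univ fun y _ => Set.mem_univ y).trans
        measureReal_le_one)) (Real.sqrt_le_sqrt (hle ν _ Bᶜ fun y hy => (Finset.mem_filter.1 hy).2))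
      (Real.sqrt_nonneg _) zero_le_one

/-- Each affinity is `1` minus half the divergence, and affinities multiply. Sums are truncated at
`N`, with `N → ∞` at the end; the maximum with 0 keeps the factors nonnegative, so that the products
can be compared. -/
theorem one_sub_half_pow_le {n : ℕ} (μ ν : Fin n → Measure ℕ) [∀ i, IsProbabilityMeasure (μ i)]
    [∀ i, IsProbabilityMeasure (ν i)] {H : ℝ}
    (hH : ∀ i N, ∑ y ∈ Finset.range N,
      (Real.sqrt ((μ i).real {y}) - Real.sqrt ((ν i).real {y})) ^ 2 ≤ H) (B : Set (Fin n → ℕ)) :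
    (max 0 (1 - H / 2)) ^ n ≤
      Real.sqrt ((Measure.pi μ).real B) + Real.sqrt ((Measure.pi ν).real Bᶜ) := by
  let g : Fin n → ℕ → ℝ := fun i N => max 0 ((∑ y ∈ Finset.range N, (μ i).real {y} +
    ∑ y ∈ Finset.range N, (ν i).real {y}) / 2 - H / 2)
  have hg : Filter.Tendsto (fun N => ∏ i, g i N) Filter.atTop
      (nhds (∏ _i : Fin n, max 0 (1 - H / 2))) := by
    refine tendsto_finsetProd _ fun i _ => tendsto_const_nhds.max ?_
    have := (((tendsto_sum_real_singleton (μ i)).add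
      (tendsto_sum_real_singleton (ν i))).div_const 2).sub_const (H / 2)
    rwa [add_self_div_two] at this
  rw [Finset.prod_const, Finset.card_univ, Fintype.card_fin] at hg
  refine le_of_tendsto' hg fun N => le_trans ?_ (prod_affinity_le μ ν B N)
  refine Finset.prod_le_prod (fun i _ => le_max_left _ _) fun i _ => max_le
    (Finset.sum_nonneg fun y _ => by positivity) ?_
  have e : ∀ y, Real.sqrt ((μ i).real {y}) * Real.sqrt ((ν i).real {y}) =
      ((μ i).real {y} + (ν i).real {y} -
        (Real.sqrt ((μ i).real {y}) - Real.sqrt ((ν i).real {y})) ^ 2) / 2 := by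
    intro y
    rw [sub_sq, Real.sq_sqrt measureReal_nonneg, Real.sq_sqrt measureReal_nonneg]
    ring
  rw [Finset.sum_congr rfl fun y _ => e y, ← Finset.sum_div, Finset.sum_sub_distrib,
    Finset.sum_add_distrib]
  linarith [hH i N]

/-- If no private channel has output divergence more than `H`, at least `1 / H` samples are
needed. -/
theorem one_le_mul_of_solves {k n : ℕ} {ε H : ℝ} {p q : Simplex k} {s : TestRule k ε}
    (hH : ∀ (T : LDPChannel k ε) (N : ℕ), ∑ y ∈ Finset.range N,
      (Real.sqrt ((messageLaw p T.1).real {y}) - Real.sqrt ((messageLaw q T.1).real {y})) ^ 2 ≤ H)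
    (h : Solves p q s n) : 1 ≤ n * H := by
  unfold Solves at h
  rw [messageProb_eq, messageProb_eq] at h
  have hc : ({y | s.1 n y ≠ Answer.isQ} : Set (Fin n → ℕ)) = {y | s.1 n y ≠ Answer.isP}ᶜ := by
    ext y
    cases hy : s.1 n y <;> simp [hy]
  rw [hc] at h
  have key := one_sub_half_pow_le (fun i => messageLaw p (s.2 n i).1)
    (fun i => messageLaw q (s.2 n i).1) (fun i N => hH (s.2 n i) N)
    {y | s.1 n y ≠ Answer.isP}
  set u := (Measure.pi fun i => messageLaw p (s.2 n i).1).real {y | s.1 n y ≠ Answer.isP}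
  set v := (Measure.pi fun i => messageLaw q (s.2 n i).1).real {y | s.1 n y ≠ Answer.isP}ᶜ
  have hu : 0 ≤ u := measureReal_nonneg
  have hv : 0 ≤ v := measureReal_nonneg
  -- `√u + √v ≤ √(2(u + v)) ≤ √0.2 < 1/2`. If `nH < 1`, Bernoulli's inequality makes the affinity
  -- exceed `1/2`.
  have hs : Real.sqrt u + Real.sqrt v ≤ 1 / 2 := by
    nlinarith [Real.sq_sqrt hu, Real.sq_sqrt hv, sq_nonneg (Real.sqrt u - Real.sqrt v),
      Real.sqrt_nonneg u, Real.sqrt_nonneg v]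
  rcases Nat.eq_zero_or_pos n with rfl | hn
  · rw [pow_zero] at key
    linarith
  · have hn' : (1 : ℝ) ≤ n := by exact_mod_cast hn
    by_contra! hlt
    have hH1 : H < 1 := by nlinarith
    have hb := one_add_mul_le_pow (show (-2 : ℝ) ≤ -(H / 2) by linarith) n
    rw [max_eq_right (by linarith)] at key
    rw [← sub_eq_add_neg] at hb
    linarith

/-! ### The hard pair -/

/-- Factor `(a - b)² = (√a - √b)²(√a + √b)²` and use `(√a + √b)² ≥ a + b`. This removes square roots
from the divergence estimates. -/
theorem sq_sqrt_sub_sqrt_le_of_sq_sub_le {a b G : ℝ} (ha : 0 ≤ a) (hb : 0 ≤ b) (hG : 0 ≤ G)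
    (h : (a - b) ^ 2 ≤ G * (a + b)) : (Real.sqrt a - Real.sqrt b) ^ 2 ≤ G := by
  rcases (add_nonneg ha hb).eq_or_lt with h0 | h0
  · have h1 : a = 0 := by linarith
    have h2 : b = 0 := by linarith
    simpa [h1, h2] using hG
  · refine le_of_mul_le_mul_right (le_trans ?_ h) h0
    have hs : 0 ≤ Real.sqrt a * Real.sqrt b := by positivity
    have e : (a - b) ^ 2 = (Real.sqrt a - Real.sqrt b) ^ 2 * (Real.sqrt a + Real.sqrt b) ^ 2 := by
      rw [← mul_pow, mul_comm, ← sq_sub_sq, Real.sq_sqrt ha, Real.sq_sqrt hb]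
    rw [e]
    gcongr
    rw [add_sq, Real.sq_sqrt ha, Real.sq_sqrt hb]
    linarith

/-- The first distribution of the hard pair. -/
def hardP (x ν : ℝ) (hx : 0 ≤ x) (hν : ν ≤ 1) (hxν : 2 * x ≤ 1 + ν) : Simplex 4 :=
  ⟨![x, 0, (1 + ν - 2 * x) / 2, (1 - ν) / 2],
    fun i => by fin_cases i <;> simp <;> linarith,
    by simp [Fin.sum_univ_four]; ring⟩

/-- The second distribution of the hard pair. -/
def hardQ (x ν : ℝ) (hx : 0 ≤ x) (hν : ν ≤ 1) (hxν : 2 * x ≤ 1 + ν) : Simplex 4 :=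
  ⟨![0, x, (1 - ν) / 2, (1 + ν - 2 * x) / 2],
    fun i => by fin_cases i <;> simp <;> linarith,
    by simp [Fin.sum_univ_four]; ring⟩

section HardPair

variable {x ν : ℝ} (hx : 0 ≤ x) (hν : ν ≤ 1) (hxν : 2 * x ≤ 1 + ν)

theorem sum_hardP_mul (f : Fin 4 → ℝ) : ∑ i, hardP x ν hx hν hxν i * f i =
    x * f 0 + (1 + ν - 2 * x) / 2 * f 2 + (1 - ν) / 2 * f 3 := by
  rw [Fin.sum_univ_four]
  change x * f 0 + 0 * f 1 + (1 + ν - 2 * x) / 2 * f 2 + (1 - ν) / 2 * f 3 = _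
  ring

theorem sum_hardQ_mul (f : Fin 4 → ℝ) : ∑ i, hardQ x ν hx hν hxν i * f i =
    x * f 1 + (1 - ν) / 2 * f 2 + (1 + ν - 2 * x) / 2 * f 3 := by
  rw [Fin.sum_univ_four]
  change 0 * f 0 + x * f 1 + (1 - ν) / 2 * f 2 + (1 + ν - 2 * x) / 2 * f 3 = _
  ring

theorem tv_hard (h : x ≤ ν) : tv (hardP x ν hx hν hxν) (hardQ x ν hx hν hxν) = ν := by
  rw [tv, Fin.sum_univ_four]
  change 1 / 2 * (|x - 0| + |0 - x| + |(1 + ν - 2 * x) / 2 - (1 - ν) / 2| +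
    |(1 - ν) / 2 - (1 + ν - 2 * x) / 2|) = ν
  rw [abs_sub_comm 0 x, abs_sub_comm ((1 - ν) / 2), sub_zero, abs_of_nonneg hx, abs_of_nonneg]
  · ring
  · linarith

theorem hellingerSq_hard : hellingerSq (hardP x ν hx hν hxν) (hardQ x ν hx hν hxν) =
    2 - 2 * Real.sqrt ((1 + ν - 2 * x) * (1 - ν)) := by
  rw [hellingerSq, Fin.sum_univ_four]
  change (Real.sqrt x - Real.sqrt 0) ^ 2 + (Real.sqrt 0 - Real.sqrt x) ^ 2 +
    (Real.sqrt ((1 + ν - 2 * x) / 2) - Real.sqrt ((1 - ν) / 2)) ^ 2 +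
    (Real.sqrt ((1 - ν) / 2) - Real.sqrt ((1 + ν - 2 * x) / 2)) ^ 2 = _
  have h1 : 0 ≤ 1 + ν - 2 * x := by linarith
  have h2 : 0 ≤ 1 - ν := by linarith
  have e : Real.sqrt ((1 + ν - 2 * x) * (1 - ν)) =
      2 * (Real.sqrt ((1 + ν - 2 * x) / 2) * Real.sqrt ((1 - ν) / 2)) := by
    rw [← Real.sqrt_mul (by positivity),
      show (1 + ν - 2 * x) / 2 * ((1 - ν) / 2) = (1 + ν - 2 * x) * (1 - ν) / 2 ^ 2 by ring,
      Real.sqrt_div (by positivity), Real.sqrt_sq (by norm_num)]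
    ring
  rw [e, Real.sqrt_zero]
  simp only [sub_sq, Real.sq_sqrt hx, Real.sq_sqrt (div_nonneg h1 zero_le_two),
    Real.sq_sqrt (div_nonneg h2 zero_le_two)]
  ring

end HardPair

/-- The equation for `x` is linear; it says that the hard pair has divergence exactly `ρ`. The
hypothesis `2ν² ≤ ρ` yields `0 ≤ x`, and `ρ ≤ ν` yields `x ≤ ν/2`. -/
theorem exists_hard_parameter {ρ ν : ℝ} (hν : 0 < ν) (hν' : ν < 1 / 2)
    (hρ : 2 * ν ^ 2 ≤ ρ) (hρ' : ρ ≤ ν) :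
    ∃ x, 0 ≤ x ∧ x ≤ ρ ∧ x ≤ ν / 2 ∧ (1 + ν - 2 * x) * (1 - ν) = (1 - ρ / 2) ^ 2 := by
  have h1 : 0 < 2 * (1 - ν) := by linarith
  refine ⟨(ρ - ρ ^ 2 / 4 - ν ^ 2) / (2 * (1 - ν)), div_nonneg (by nlinarith) h1.le,
    (div_le_iff₀ h1).2 (by nlinarith), (div_le_iff₀ h1).2 (by nlinarith), ?_⟩
  have : 1 - ν ≠ 0 := by linarith
  field_simp
  ring

/-! ### Divergence bounds for private channels on the hard pair -/

section Pointwise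

variable {x ν e : ℝ} {c : Fin 4 → ℝ}

theorem hard_sub_eq : x * c 0 + (1 + ν - 2 * x) / 2 * c 2 + (1 - ν) / 2 * c 3 -
    (x * c 1 + (1 - ν) / 2 * c 2 + (1 + ν - 2 * x) / 2 * c 3) =
      x * (c 0 - c 1) + (ν - x) * (c 2 - c 3) := by ring

theorem hard_add_eq : x * c 0 + (1 + ν - 2 * x) / 2 * c 2 + (1 - ν) / 2 * c 3 +
    (x * c 1 + (1 - ν) / 2 * c 2 + (1 + ν - 2 * x) / 2 * c 3) =
      x * (c 0 + c 1) + (1 - x) * (c 2 + c 3) := by ring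

theorem abs_sub_le_of_ratio (he : 1 ≤ e) (hr : ∀ i j, c i ≤ e * c j) (i j l : Fin 4) :
    |c i - c j| ≤ (e - 1) * c l := by
  have main : ∀ i j, c i - c j ≤ (e - 1) * c l := by
    intro i j
    rcases le_total (c j) (c l) with h | h
    · have := mul_le_mul_of_nonneg_left h (sub_nonneg.2 he)
      linarith [hr i j]
    · linarith [hr i l]
  exact abs_sub_le_iff.2 ⟨main i j, main j i⟩

/-- Both differences are at most `(e - 1) c 2`, with total weight `x + (ν - x) = ν`, while the heavy
atoms keep the summed mass above `c 2 / 2`. -/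
theorem hard_sq_le_weak (hx : 0 ≤ x) (hx' : x ≤ 1 / 2) (hxν : x ≤ ν) (he : 1 ≤ e)
    (hc : ∀ i, 0 ≤ c i) (hr : ∀ i j, c i ≤ e * c j) :
    (x * (c 0 - c 1) + (ν - x) * (c 2 - c 3)) ^ 2 ≤
      2 * ν ^ 2 * (e - 1) ^ 2 * c 2 * (x * (c 0 + c 1) + (1 - x) * (c 2 + c 3)) := by
  have h1 := abs_sub_le_of_ratio he hr 0 1 2
  have h2 := abs_sub_le_of_ratio he hr 2 3 2
  have hd : |x * (c 0 - c 1) + (ν - x) * (c 2 - c 3)| ≤ ν * ((e - 1) * c 2) := by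
    refine (abs_add_le _ _).trans ?_
    rw [abs_mul, abs_mul, abs_of_nonneg hx, abs_of_nonneg (sub_nonneg.2 hxν)]
    nlinarith
  have hS : c 2 / 2 ≤ x * (c 0 + c 1) + (1 - x) * (c 2 + c 3) := by
    nlinarith [mul_nonneg hx (hc 0), mul_nonneg hx (hc 1), hc 2,
      mul_nonneg (show 0 ≤ 1 - x by linarith) (hc 3)]
  have h2' := hc 2
  calc _ = |x * (c 0 - c 1) + (ν - x) * (c 2 - c 3)| ^ 2 := (sq_abs _).symm
    _ ≤ (ν * ((e - 1) * c 2)) ^ 2 := by gcongr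
    _ = 2 * ν ^ 2 * (e - 1) ^ 2 * c 2 * (c 2 / 2) := by ring
    _ ≤ _ := by gcongr

/-- `(A + B)² ≤ 2A² + 2B²` separates light from heavy atoms; the heavy part is absorbed by the mass
`(c 2 + c 3)/2`, and `g` is left for the light part. -/
theorem hard_sq_le_split (hx' : x ≤ 1 / 2) (hx : 0 ≤ x) (hxν : x ≤ ν)
    (hc : ∀ i, 0 ≤ c i) {g : ℝ}
    (hg : 2 * x ^ 2 * (c 0 - c 1) ^ 2 ≤ g * (x * (c 0 + c 1) + (1 - x) * (c 2 + c 3))) :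
    (x * (c 0 - c 1) + (ν - x) * (c 2 - c 3)) ^ 2 ≤
      (4 * ν ^ 2 * (c 2 + c 3) + g) * (x * (c 0 + c 1) + (1 - x) * (c 2 + c 3)) := by
  have h01 : 0 ≤ x * (c 0 + c 1) := mul_nonneg hx (add_nonneg (hc 0) (hc 1))
  have h23 : 0 ≤ c 2 + c 3 := add_nonneg (hc 2) (hc 3)
  have hS : (c 2 + c 3) / 2 ≤ x * (c 0 + c 1) + (1 - x) * (c 2 + c 3) := by nlinarith
  have hd : (c 2 - c 3) ^ 2 ≤ (c 2 + c 3) ^ 2 := by nlinarith [mul_nonneg (hc 2) (hc 3)]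
  have hν : (ν - x) ^ 2 ≤ ν ^ 2 := by nlinarith
  calc _ ≤ 2 * x ^ 2 * (c 0 - c 1) ^ 2 + 2 * ((ν - x) ^ 2 * (c 2 - c 3) ^ 2) := by
        nlinarith [sq_nonneg (x * (c 0 - c 1) - (ν - x) * (c 2 - c 3))]
    _ ≤ g * (x * (c 0 + c 1) + (1 - x) * (c 2 + c 3)) + 2 * (ν ^ 2 * (c 2 + c 3) ^ 2) := by gcongr
    _ = g * (x * (c 0 + c 1) + (1 - x) * (c 2 + c 3)) +
          4 * ν ^ 2 * (c 2 + c 3) * ((c 2 + c 3) / 2) := by ring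
    _ ≤ g * (x * (c 0 + c 1) + (1 - x) * (c 2 + c 3)) + 4 * ν ^ 2 * (c 2 + c 3) *
          (x * (c 0 + c 1) + (1 - x) * (c 2 + c 3)) := by gcongr
    _ = _ := by ring

theorem hard_light_le_linear (hx' : x ≤ 1 / 2) (hx : 0 ≤ x) (hc : ∀ i, 0 ≤ c i) :
    2 * x ^ 2 * (c 0 - c 1) ^ 2 ≤
      2 * x * (c 0 + c 1) * (x * (c 0 + c 1) + (1 - x) * (c 2 + c 3)) := by
  have h01 := add_nonneg (hc 0) (hc 1)
  have h23 := mul_nonneg (show 0 ≤ 1 - x by linarith) (add_nonneg (hc 2) (hc 3))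
  have hd : (c 0 - c 1) ^ 2 ≤ (c 0 + c 1) ^ 2 := by nlinarith [mul_nonneg (hc 0) (hc 1)]
  calc _ ≤ 2 * x ^ 2 * (c 0 + c 1) ^ 2 := by gcongr
    _ = 2 * x * (c 0 + c 1) * (x * (c 0 + c 1)) := by ring
    _ ≤ _ := by gcongr; linarith

/-- Privacy replaces one factor `c 0` or `c 1` by `e * c 2`, which the heavy mass pays for; this
turns a bound linear in `x` into one of order `e x²`. -/
theorem hard_light_le_private (hx' : x ≤ 1 / 2) (hx : 0 ≤ x) (he : 1 ≤ e) (hc : ∀ i, 0 ≤ c i)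
    (hr : ∀ i j, c i ≤ e * c j) :
    2 * x ^ 2 * (c 0 - c 1) ^ 2 ≤
      4 * x ^ 2 * e * (c 0 + c 1) * (x * (c 0 + c 1) + (1 - x) * (c 2 + c 3)) := by
  have h01 := add_nonneg (hc 0) (hc 1)
  have hS : c 2 / 2 ≤ x * (c 0 + c 1) + (1 - x) * (c 2 + c 3) := by
    nlinarith [mul_nonneg hx h01, hc 2, mul_nonneg (show 0 ≤ 1 - x by linarith) (hc 3)]
  have hd : (c 0 - c 1) ^ 2 ≤ (c 0 + c 1) * (e * c 2) := by
    nlinarith [hc 0, hc 1, hr 0 2, hr 1 2, mul_nonneg (hc 0) (hc 1),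
      mul_nonneg (hc 0) (sub_nonneg.2 (hr 0 2)), mul_nonneg (hc 1) (sub_nonneg.2 (hr 1 2))]
  calc _ ≤ 2 * x ^ 2 * ((c 0 + c 1) * (e * c 2)) := by gcongr
    _ = 4 * x ^ 2 * e * (c 0 + c 1) * (c 2 / 2) := by ring
    _ ≤ _ := by gcongr

end Pointwise

theorem sum_toReal_le_one (T : PMF ℕ) (N : ℕ) : ∑ y ∈ Finset.range N, (T y).toReal ≤ 1 := by
  have : ∀ y, (T y).toReal = T.toMeasure.real {y} := fun y => by
    rw [measureReal_def, PMF.toMeasure_apply_singleton _ _ (measurableSet_singleton y)]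
  rw [Finset.sum_congr rfl fun y _ => this y]
  exact sum_range_real_singleton_le_one _ N

/-- A pointwise bound on the squared difference of the two output laws, relative to their sum,
gives a lower bound on the number of samples for the hard pair. -/
theorem one_le_mul_of_solves_hard {x ν ε H : ℝ} {hx : 0 ≤ x} {hν : ν ≤ 1}
    {hxν : 2 * x ≤ 1 + ν} {n : ℕ} {s : TestRule 4 ε} (w : Fin 4 → ℝ) (hw : ∀ i, 0 ≤ w i)
    (hwH : ∑ i, w i ≤ H)
    (h : ∀ c : Fin 4 → ℝ, (∀ i, 0 ≤ c i) → (∀ i j, c i ≤ Real.exp ε * c j) →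
      (x * (c 0 - c 1) + (ν - x) * (c 2 - c 3)) ^ 2 ≤
        (∑ i, w i * c i) * (x * (c 0 + c 1) + (1 - x) * (c 2 + c 3)))
    (hs : Solves (hardP x ν hx hν hxν) (hardQ x ν hx hν hxν) s n) : 1 ≤ n * H := by
  refine one_le_mul_of_solves (fun T N => ?_) hs
  calc _ ≤ ∑ y ∈ Finset.range N, ∑ i, w i * (T.1 i y).toReal := by
        refine Finset.sum_le_sum fun y _ => sq_sqrt_sub_sqrt_le_of_sq_sub_le measureReal_nonneg
          measureReal_nonneg (Finset.sum_nonneg fun i _ => mul_nonneg (hw i)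
            ENNReal.toReal_nonneg) ?_
        rw [messageLaw_real_singleton, messageLaw_real_singleton,
          sum_hardP_mul hx hν hxν fun i => (T.1 i y).toReal,
          sum_hardQ_mul hx hν hxν fun i => (T.1 i y).toReal,
          hard_sub_eq (c := fun i => (T.1 i y).toReal), hard_add_eq (c := fun i => (T.1 i y).toReal)]
        exact h (fun i => (T.1 i y).toReal) (fun i => ENNReal.toReal_nonneg)
          fun i j => T.2.toReal_le i j y
    _ = ∑ i, w i * ∑ y ∈ Finset.range N, (T.1 i y).toReal := by
        rw [Finset.sum_comm]; simp only [Finset.mul_sum]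
    _ ≤ ∑ i, w i * 1 := by
        gcongr with i _
        · exact hw i
        · exact sum_toReal_le_one _ N
    _ ≤ H := by simpa using hwH

/-- There is a pair with prescribed distances for which every private protocol needs many
samples. -/
theorem exists_hard_pair {ρ ν ε : ℝ} (hν : 0 < ν) (hν' : ν < 1 / 2) (hρ : 2 * ν ^ 2 ≤ ρ)
    (hρ' : ρ ≤ ν) (hε : 0 < ε) :
    ∃ p q : Simplex 4, tv p q = ν ∧ hellingerSq p q = ρ ∧
      ∀ (s : TestRule 4 ε) (n : ℕ), Solves p q s n →
        1 ≤ n * (2 * ν ^ 2 * (Real.exp ε - 1) ^ 2) ∧ 1 ≤ n * (8 * ρ) ∧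
        1 ≤ n * (8 * ν ^ 2 + 8 * (Real.exp ε * ρ ^ 2)) := by
  obtain ⟨x, hx0, hxρ, hxν, hx⟩ := exists_hard_parameter hν hν' hρ hρ'
  have he : 1 ≤ Real.exp ε := Real.one_le_exp hε.le
  have h1 : ν ≤ 1 := by linarith
  have h2 : 2 * x ≤ 1 + ν := by linarith
  have hx12 : x ≤ 1 / 2 := by linarith
  have hxν' : x ≤ ν := by linarith
  refine ⟨hardP x ν hx0 h1 h2, hardQ x ν hx0 h1 h2, tv_hard hx0 h1 h2 hxν', ?_, fun s n hs =>
    ⟨?_, ?_, ?_⟩⟩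
  · rw [hellingerSq_hard, hx, Real.sqrt_sq (by linarith)]; ring
  · refine one_le_mul_of_solves_hard ![0, 0, 2 * ν ^ 2 * (Real.exp ε - 1) ^ 2, 0]
      (fun i => ?_) (by simp [Fin.sum_univ_four]) (fun c hc hr => ?_) hs
    · fin_cases i <;> simp; positivity
    · refine (hard_sq_le_weak hx0 hx12 hxν' he hc hr).trans (le_of_eq ?_)
      simp [Fin.sum_univ_four]
  -- The weights sum to `4x + 8ν² ≤ 8ρ`, by `x ≤ ρ` and `2ν² ≤ ρ`.
  · refine one_le_mul_of_solves_hard ![2 * x, 2 * x, 4 * ν ^ 2, 4 * ν ^ 2]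
      (fun i => ?_) ?_ (fun c hc hr => ?_) hs
    · fin_cases i <;> simp <;> positivity
    · simp only [Fin.sum_univ_four, Matrix.cons_val]; linarith
    · refine (hard_sq_le_split hx12 hx0 hxν' hc (hard_light_le_linear hx12 hx0 hc)).trans
        (le_of_eq ?_)
      simp only [Fin.sum_univ_four, Matrix.cons_val]; ring
  · refine one_le_mul_of_solves_hard
      ![4 * x ^ 2 * Real.exp ε, 4 * x ^ 2 * Real.exp ε, 4 * ν ^ 2, 4 * ν ^ 2]
      (fun i => ?_) ?_ (fun c hc hr => ?_) hs
    · fin_cases i <;> simp <;> positivity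
    · simp only [Fin.sum_univ_four, Matrix.cons_val]
      have : Real.exp ε * x ^ 2 ≤ Real.exp ε * ρ ^ 2 := by gcongr
      linarith
    · refine (hard_sq_le_split hx12 hx0 hxν' hc
        (hard_light_le_private hx12 hx0 he hc hr)).trans (le_of_eq ?_)
      simp only [Fin.sum_univ_four, Matrix.cons_val]; ring

/-! ### The minimax sample complexity -/

/-- A uniform upper bound and one hard pair determine the minimax sample complexity. -/
theorem eqUpToPolylog_of_bounds {C h ρ ν ε r : ℝ} {a : ℕ} (hh : 0 < h) (hh1 : h ≤ 1)
    (hC : 1 ≤ C) (hL : 1 ≤ Real.log (1 / ν) + Real.log (1 / ρ))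
    (hupper : ∀ (k : ℕ) (p q : Simplex k), tv p q = ν → hellingerSq p q = ρ →
      nStar p q ε ≤ (⌈80 / h⌉₊ : ℕ))
    (hbound : 81 / h ≤ C * (Real.log (1 / ν) + Real.log (1 / ρ)) ^ a * r)
    (hlower : ∃ p q : Simplex 4, tv p q = ν ∧ hellingerSq p q = ρ ∧
      ∀ (s : TestRule 4 ε) (n : ℕ), Solves p q s n → r ≤ n * C) :
    EqUpToPolylog C a ρ ν (minimaxSamples ρ ν ε) r := by
  have hle : minimaxSamples ρ ν ε ≤ (⌈80 / h⌉₊ : ℕ) := by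
    rw [minimaxSamples_eq]
    exact iSup_le fun x => hupper _ _ _ x.2.1 x.2.2
  obtain ⟨N, hN⟩ := ENat.ne_top_iff_exists.1 (ne_top_of_le_ne_top (ENat.natCast_ne_top _) hle)
  have hC0 : 0 < C := by linarith
  refine ⟨N, hN.symm, ?_, ?_⟩
  · obtain ⟨p, q, htv, hhel, hpq⟩ := hlower
    have hst : nStar p q ε ≤ N := by
      rw [hN, minimaxSamples_eq]
      exact le_iSup (fun x : pairSet ρ ν => nStar x.1.2.1 x.1.2.2 ε) ⟨⟨4, p, q⟩, htv, hhel⟩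
    obtain ⟨m, hm, hmN⟩ : ∃ m : ℕ, (∃ s : TestRule 4 ε, Solves p q s m) ∧ m ≤ N := by
      by_contra! hno
      have : ((N + 1 : ℕ) : ℕ∞) ≤ nStar p q ε :=
        le_iInf₂ fun m hm => by exact_mod_cast hno m hm
      have := this.trans hst
      norm_cast at this
      omega
    obtain ⟨s, hs⟩ := hm
    have hL' := one_le_pow₀ hL (n := a)
    have hmN' : (m : ℝ) ≤ N := by exact_mod_cast hmN
    rw [div_le_iff₀ (by positivity)]
    calc r ≤ m * C := hpq s m hs
      _ ≤ N * C := by gcongr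
      _ = N * (C * 1) := by ring
      _ ≤ _ := by gcongr
  · rw [← hN] at hle
    have hle' : (N : ℝ) ≤ ⌈80 / h⌉₊ := by exact_mod_cast hle
    -- The ceiling costs at most `1 ≤ 1/h`, turning 80 into 81.
    have h1 := (Nat.ceil_lt_add_one (show 0 ≤ 80 / h by positivity)).le
    have h2 : 1 ≤ 1 / h := (one_le_div hh).2 hh1
    have h3 : 81 / h = 80 / h + 1 / h := by ring
    linarith

theorem one_le_log_add_log {ρ ν : ℝ} (hρ : 0 < ρ) (hρ' : ρ < 1 / 2) (hν : 0 < ν)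
    (hν' : ν < 1 / 2) : 1.38 ≤ Real.log (1 / ν) + Real.log (1 / ρ) := by
  have h : ∀ x : ℝ, 0 < x → x < 1 / 2 → 0.69 ≤ Real.log (1 / x) := fun x hx hx' => by
    have h2 : Real.log 2 ≤ Real.log (1 / x) :=
      Real.log_le_log two_pos ((le_div_iff₀ hx).2 (by linarith))
    linarith [Real.log_two_gt_d9]
  linarith [h ρ hρ hρ', h ν hν hν']

/-- A logarithmic number of dyadic levels suffices. -/
theorem exists_levels {ρ L : ℝ} (hρ : 0 < ρ) (hρ1 : ρ ≤ 1) (hL : 1.38 ≤ L)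
    (hL' : Real.log (1 / ρ) ≤ L) :
    ∃ J : ℕ, 0 < J ∧ (1 / 4 : ℝ) ^ J ≤ ρ / 4 ∧ (J : ℝ) ≤ 3 * L := by
  have h4 : Real.log 4 = 2 * Real.log 2 := by
    rw [show (4 : ℝ) = 2 ^ 2 by norm_num, Real.log_pow]; norm_num
  have hlog : Real.log (4 / ρ) = Real.log 4 + Real.log (1 / ρ) := by
    rw [← Real.log_mul (by norm_num) (by positivity), mul_one_div]
  have hpos : 0 < Real.log (4 / ρ) := Real.log_pos ((one_lt_div hρ).2 (by linarith))
  refine ⟨⌈Real.log (4 / ρ)⌉₊, Nat.ceil_pos.2 hpos, ?_, ?_⟩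
  · rw [one_div_pow, div_le_div_iff₀ (by positivity) (by norm_num), one_mul, ← div_le_iff₀' hρ]
    calc 4 / ρ = Real.exp (Real.log (4 / ρ)) := (Real.exp_log (by positivity)).symm
      _ ≤ Real.exp ⌈Real.log (4 / ρ)⌉₊ := Real.exp_le_exp.2 (Nat.le_ceil _)
      _ = Real.exp 1 ^ ⌈Real.log (4 / ρ)⌉₊ := by rw [← Real.exp_nat_mul, mul_one]
      _ ≤ 4 ^ ⌈Real.log (4 / ρ)⌉₊ := by gcongr; linarith [Real.exp_one_lt_d9]
  · linarith [Nat.ceil_lt_add_one hpos.le, Real.log_two_lt_d9]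

/-- The bound of `nStar_le_hellinger` in terms of the distances only. -/
theorem nStar_le_hellinger_log {k : ℕ} {ε ρ L h : ℝ} (hε : 2 ≤ Real.exp ε) (hρ : 0 < ρ) (hρ1 : ρ ≤ 1)
    (hL : 1.38 ≤ L) (hL' : Real.log (1 / ρ) ≤ L)
    (hh : 0 < h) (hhρ : h ≤ ρ) (hhε : h ≤ Real.exp ε * ρ ^ 2) (p q : Simplex k)
    (hpq : hellingerSq p q = ρ) :
    nStar p q ε ≤ (⌈80 / (h / (41472 * L ^ 2))⌉₊ : ℕ) := by
  obtain ⟨J, hJ, hJ4, hJL⟩ := exists_levels hρ hρ1 hL hL'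
  have hL0 : 0 < L := by linarith
  have hJ' : (0 : ℝ) < J := by exact_mod_cast hJ
  -- `J ≤ 3L` gives `16J ≤ 48L`; squaring `τ` produces `41472 = 18 · 48²`.
  have := nStar_le_hellinger (τ := ρ / (48 * L)) hε p q hJ (by rwa [hpq]) (by rwa [hpq])
    (by positivity) (by
      rw [hpq]
      exact div_le_div_of_nonneg_left hρ.le (by positivity) (by linarith))
  refine this.trans (Nat.cast_le.2 (Nat.ceil_le_ceil ?_))
  have h1 : h / (48 * L) ^ 2 ≤ ρ / (48 * L) := by
    calc _ ≤ ρ / (48 * L) ^ 2 := by gcongr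
      _ ≤ ρ / (48 * L) := by
        gcongr
        nlinarith
  have h2 : h / (48 * L) ^ 2 ≤ Real.exp ε * (ρ / (48 * L)) ^ 2 := by
    rw [div_pow, ← mul_div_assoc]
    gcongr
  have e : h / (41472 * L ^ 2) = h / (48 * L) ^ 2 / 18 := by field_simp; norm_num
  rw [e]
  gcongr
  exact le_min h1 h2

end LDPTesting
end

theorem mainTheorem4 :
    ∃ (C : ℝ) (a : ℕ), 0 < C ∧
      ∀ ρ ν ε : ℝ, 0 < ρ → ρ < 1 / 2 → 0 < ν → ν < 1 / 2 → 2 * ν ^ 2 ≤ ρ → ρ ≤ ν → 0 < ε →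
        (ε ≤ 1 →
          LDPTesting.EqUpToPolylog C a ρ ν (LDPTesting.minimaxSamples ρ ν ε)
            (1 / (ε ^ 2 * ν ^ 2))) ∧
        (Real.exp 1 ≤ Real.exp ε → Real.exp ε ≤ 1 / ρ →
          LDPTesting.EqUpToPolylog C a ρ ν (LDPTesting.minimaxSamples ρ ν ε)
            (min (1 / ν ^ 2) (1 / (Real.exp ε * ρ ^ 2)))) ∧
        (1 / ρ < Real.exp ε →
          LDPTesting.EqUpToPolylog C a ρ ν (LDPTesting.minimaxSamples ρ ν ε) (1 / ρ)) := by
  -- The exponent 2 comes from `τ²`; the constant exceeds `81 · 41472`.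
  refine ⟨4000000, 2, by norm_num, fun ρ ν ε hρ hρ' hν hν' h1 h2 hε => ?_⟩
  have hL := LDPTesting.one_le_log_add_log hρ hρ' hν hν'
  have hlog : Real.log (1 / ρ) ≤ Real.log (1 / ν) + Real.log (1 / ρ) := by
    have : 0 ≤ Real.log (1 / ν) := Real.log_nonneg ((one_le_div hν).2 (by linarith))
    linarith
  obtain ⟨p, q, htv, hhel, hlow⟩ := LDPTesting.exists_hard_pair hν hν' h1 h2 hε
  set L := Real.log (1 / ν) + Real.log (1 / ρ)
  have hL1 : 1 ≤ L := by linarith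
  have hL2 : 1 ≤ L ^ 2 := one_le_pow₀ hL1
  have he := Real.exp_pos ε
  have hlarge : ∀ h : ℝ, 0 < h → h ≤ 1 → 81 / (h / (41472 * L ^ 2)) ≤ 4000000 * L ^ 2 * (1 / h) := by
    intro h hh _
    rw [div_div_eq_mul_div, mul_one_div]
    exact div_le_div_of_nonneg_right (by linarith) hh.le
  refine ⟨fun hε1 => ?_, fun hε1 hεr => ?_, fun hεr => ?_⟩
  -- `e^ε - 1 ≥ ε` and `1 + e^ε ≤ 4`.
  · have hκ : ε / 4 ≤ (Real.exp ε - 1) / (1 + Real.exp ε) := by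
      have e3 : Real.exp ε ≤ 3 := by
        linarith [Real.exp_le_exp.2 hε1, Real.exp_one_lt_d9]
      rw [div_le_div_iff₀ (by norm_num) (by linarith)]
      nlinarith [Real.add_one_le_exp ε]
    have hx : 0 < ε ^ 2 * ν ^ 2 := by positivity
    have hx1 : ε ^ 2 * ν ^ 2 ≤ 1 := by
      have : ε ^ 2 ≤ 1 := pow_le_one₀ hε.le hε1
      have : ν ^ 2 ≤ 1 := pow_le_one₀ hν.le (by linarith)
      nlinarith
    refine LDPTesting.eqUpToPolylog_of_bounds (h := (ε / 4) ^ 2 * ν ^ 2) (by positivity)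
      (by linarith) (by norm_num) hL1 (fun k p q htv _ => ?_) ?_
      ⟨p, q, htv, hhel, fun s n hs => ?_⟩
    · have := LDPTesting.nStar_le_tv hε.le p q (by positivity) hκ (htv ▸ hν)
      rwa [htv] at this
    · rw [show 81 / ((ε / 4) ^ 2 * ν ^ 2) = 1296 * (1 / (ε ^ 2 * ν ^ 2)) by field_simp; norm_num]
      gcongr
      linarith
    · have hexp : (Real.exp ε - 1) ^ 2 ≤ (2 * ε) ^ 2 := by
        have h := Real.abs_exp_sub_one_le (x := ε) (by rwa [abs_of_pos hε])
        rw [abs_of_pos hε] at h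
        exact sq_le_sq' (by linarith [neg_abs_le (Real.exp ε - 1)]) ((le_abs_self _).trans h)
      rw [div_le_iff₀ hx]
      calc 1 ≤ n * (2 * ν ^ 2 * (Real.exp ε - 1) ^ 2) := (hlow s n hs).1
        _ ≤ n * (2 * ν ^ 2 * (2 * ε) ^ 2) := by gcongr
        _ = n * 8 * (ε ^ 2 * ν ^ 2) := by ring
        _ ≤ _ := by gcongr; norm_num
  · have hε2 : 2 ≤ Real.exp ε := by linarith [Real.exp_one_gt_d9]
    have hy : 0 < Real.exp ε * ρ ^ 2 := by positivity
    have hyρ : Real.exp ε * ρ ^ 2 ≤ ρ := by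
      rw [le_div_iff₀ hρ] at hεr
      nlinarith
    have hlower : ∀ (s : LDPTesting.TestRule 4 ε) (n : ℕ), LDPTesting.Solves p q s n →
        min (1 / ν ^ 2) (1 / (Real.exp ε * ρ ^ 2)) ≤ (n : ℝ) * 4000000 := by
      intro s n hs
      have h := (hlow s n hs).2.2
      have hn : (0 : ℝ) ≤ n := n.cast_nonneg
      -- The larger of the two terms dominates their sum, which is why the minimum of the
      -- reciprocals appears.
      rcases le_total (ν ^ 2) (Real.exp ε * ρ ^ 2) with hc | hc
      · refine (min_le_right _ _).trans ((div_le_iff₀ hy).2 ?_)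
        nlinarith [mul_le_mul_of_nonneg_left hc hn, mul_nonneg hn hy.le]
      · refine (min_le_left _ _).trans ((div_le_iff₀ (by positivity)).2 ?_)
        nlinarith [mul_le_mul_of_nonneg_left hc hn, mul_nonneg hn (sq_nonneg ν)]
    rcases le_total (1 / ν ^ 2) (1 / (Real.exp ε * ρ ^ 2)) with hc | hc
    · refine LDPTesting.eqUpToPolylog_of_bounds (h := (1 / 3) ^ 2 * ν ^ 2) (by positivity)
        (by nlinarith) (by norm_num) hL1 (fun k p q htv _ => ?_) ?_
        ⟨p, q, htv, hhel, hlower⟩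
      · have := LDPTesting.nStar_le_tv hε.le p q (by norm_num)
          (LDPTesting.one_third_le_of_two_le_exp hε2) (htv ▸ hν)
        rwa [htv] at this
      · rw [min_eq_left hc,
          show 81 / ((1 / 3) ^ 2 * ν ^ 2) = 729 * (1 / ν ^ 2) by field_simp; norm_num]
        gcongr
        linarith
    · refine LDPTesting.eqUpToPolylog_of_bounds (h := Real.exp ε * ρ ^ 2 / (41472 * L ^ 2))
        (by positivity) ((div_le_one (by positivity)).2 (by linarith)) (by norm_num) hL1
        (fun k p q _ hhel => LDPTesting.nStar_le_hellinger_log hε2 hρ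
          (by linarith) hL hlog hy hyρ le_rfl p q hhel) ?_ ⟨p, q, htv, hhel, hlower⟩
      rw [min_eq_right hc]
      exact hlarge _ hy (by linarith)
  · have hε2 : 2 ≤ Real.exp ε := by
      have : 2 < 1 / ρ := (lt_div_iff₀ hρ).2 (by linarith)
      linarith
    have hy : ρ ≤ Real.exp ε * ρ ^ 2 := by
      rw [div_lt_iff₀ hρ] at hεr
      nlinarith
    refine LDPTesting.eqUpToPolylog_of_bounds (h := ρ / (41472 * L ^ 2))
      (by positivity) ((div_le_one (by positivity)).2 (by linarith)) (by norm_num) hL1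
      (fun k p q _ hhel => LDPTesting.nStar_le_hellinger_log hε2 hρ
        (by linarith) hL hlog hρ le_rfl hy p q hhel) (hlarge _ hρ (by linarith))
      ⟨p, q, htv, hhel, fun s n hs => ?_⟩
    rw [div_le_iff₀ hρ]
    have hn : (0 : ℝ) ≤ n := n.cast_nonneg
    nlinarith [(hlow s n hs).2.1, mul_nonneg hn hρ.le]
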